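/- A metric space $(X,d_X)$ is called uniformly locally finite if $\sup_{x\in X}|B_r(x)|<\infty$ for every $r>0$, where $|B_r(x)|$ is the cardinality of the closed ball of radius $r$ centered at $x$. A map $f\colon X\to Y$ between metric spaces is called coarse if for all $r>0$ there is $s>0$ such that, for all $x,x'\in X$, $d_X(x,x')\le r$ implies $d_Y(f(x),f(x'))\le s$. Metric spaces $X$ and $Y$ are called coarsely equivalent if there are coarse maps $f\colon X\to Y$ and $g\colon Y\to X$ with $\sup_{x\in X}d_X(x,g(f(x)))<\infty$ and $\sup_{y\in Y}d_Y(y,f(g(y)))<\infty$. Let $\ell_2(X)$ be the complex Hilbert space with orthonormal basis $(\delta_x)_{x\in X}$. A bounded operator $a$ on $\ell_2(X)$ with matrix entries $a_{xy}=\langle \delta_x, a\delta_y\rangle$ (the $\delta_x$-coordinate of $a\delta_y$) has finite propagation if $\sup\{d_X(x,y)\mid a_{xy}\neq 0\}<\infty$. The uniform Roe algebra $\mathrm{C}^*_u(X)$ is the operator-norm closure of the $*$-algebra of all bounded operators on $\ell_2(X)$ with finite propagation. **Theorem.** Let $X$ and $Y$ be uniformly locally finite metric spaces. If the uniform Roe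 algebras $\mathrm{C}^*_u(X)$ and $\mathrm{C}^*_u(Y)$ are $*$-isomorphic, then $X$ and $Y$ are coarsely equivalent. -/

import Mathlib

open scoped ENNReal

noncomputable section

namespace UniformRoe

/-! ### Coarse geometry -/

/-- A metric space is uniformly locally finite if for every `r > 0` the cardinalities of its closed
balls of radius `r` are bounded by one natural number. -/
def UniformlyLocallyFinite (X : Type*) [MetricSpace X] : Prop :=
  ∀ r : ℝ, 0 < r → ∃ N : ℕ, ∀ x : X, (Metric.closedBall x r).encard ≤ N

/-- A map `f` is coarse if for all `r > 0` there is `s > 0` such that `d(x, x') ≤ r` implies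
`d(f x, f x') ≤ s`. -/
def IsCoarse {X Y : Type*} [MetricSpace X] [MetricSpace Y] (f : X → Y) : Prop :=
  ∀ r : ℝ, 0 < r → ∃ s : ℝ, 0 < s ∧ ∀ x x' : X, dist x x' ≤ r → dist (f x) (f x') ≤ s

/-- `f` and `g` are mutual coarse inverses: both are coarse, `sup_x d(x, g (f x)) < ∞` and
`sup_y d(y, f (g y)) < ∞`. -/
def MutualCoarseInverses {X Y : Type*} [MetricSpace X] [MetricSpace Y]
    (f : X → Y) (g : Y → X) : Prop :=
  IsCoarse f ∧ IsCoarse g ∧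
    (∃ C : ℝ, ∀ x : X, dist x (g (f x)) ≤ C) ∧ (∃ C : ℝ, ∀ y : Y, dist y (f (g y)) ≤ C)

/-- `X` and `Y` are coarsely equivalent if there are mutual coarse inverses between them. -/
def CoarselyEquivalent (X Y : Type*) [MetricSpace X] [MetricSpace Y] : Prop :=
  ∃ (f : X → Y) (g : Y → X), MutualCoarseInverses f g

/-! ### The uniform Roe algebra -/

/-- The complex Hilbert space `ℓ₂(X)`. -/
abbrev ell2 (X : Type*) : Type _ := lp (fun _ : X => ℂ) 2

/-- The element `δ_x` of the standard orthonormal basis of `ℓ₂(X)`. -/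
def basisVec {X : Type*} (x : X) : ell2 X :=
  open Classical in lp.single 2 x 1

/-- The matrix entry `a_{xy} = ⟨δ_x, a δ_y⟩`, that is, the `x`-coordinate of `a δ_y`. -/
def entry {X : Type*} (a : ell2 X →L[ℂ] ell2 X) (x y : X) : ℂ :=
  a (basisVec y) x

/-- The propagation `sup {d(x, y) | a_{xy} ≠ 0} ∈ [0, ∞]` of an operator on `ℓ₂(X)`. -/
def propagation {X : Type*} [MetricSpace X] (a : ell2 X →L[ℂ] ell2 X) : ℝ≥0∞ :=
  ⨆ (x : X) (y : X) (_ : entry a x y ≠ 0), edist x y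

section helpers

variable {X : Type*}

theorem inner_basisVec (x : X) (v : ell2 X) : inner ℂ (basisVec x) v = v x := by
  classical
  rw [basisVec, lp.inner_single_left]
  simp

theorem entry_eq_inner (a : ell2 X →L[ℂ] ell2 X) (x y : X) :
    entry a x y = inner ℂ (basisVec x) (a (basisVec y)) :=
  (inner_basisVec x _).symm

theorem entry_star (a : ell2 X →L[ℂ] ell2 X) (x y : X) :
    entry (star a) x y = star (entry a y x) := by
  rw [entry_eq_inner, entry_eq_inner, ContinuousLinearMap.star_eq_adjoint,
    ContinuousLinearMap.adjoint_inner_right]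
  exact (inner_conj_symm _ _).symm

theorem entry_mul_ne_zero {a b : ell2 X →L[ℂ] ell2 X} {x y : X} (h : entry (a * b) x y ≠ 0) :
    ∃ z, entry a x z ≠ 0 ∧ entry b z y ≠ 0 := by
  by_contra! H
  apply h
  rw [entry_eq_inner, mul_apply_eq_comp, ← ContinuousLinearMap.adjoint_inner_left,
    lp.inner_eq_tsum]
  have key : ∀ z : X, inner ℂ (ContinuousLinearMap.adjoint a (basisVec x) z)
      (b (basisVec y) z) = 0 := by
    intro z
    have h1 : ContinuousLinearMap.adjoint a (basisVec x) z = star (entry a x z) := entry_star a z x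
    by_cases hz : entry a x z = 0
    · rw [h1, hz]; simp
    · have h2 : b (basisVec y) z = 0 := H z hz
      rw [h2]; simp
  rw [tsum_congr key, tsum_zero]

variable [MetricSpace X]

theorem propagation_le_iff (a : ell2 X →L[ℂ] ell2 X) (c : ℝ≥0∞) :
    propagation a ≤ c ↔ ∀ x y : X, entry a x y ≠ 0 → edist x y ≤ c := by
  simp only [propagation, iSup_le_iff]

theorem edist_le_propagation {a : ell2 X →L[ℂ] ell2 X} {x y : X} (h : entry a x y ≠ 0) :
    edist x y ≤ propagation a :=
  (propagation_le_iff a _).1 le_rfl x y h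

theorem propagation_mul_le (a b : ell2 X →L[ℂ] ell2 X) :
    propagation (a * b) ≤ propagation a + propagation b := by
  rw [propagation_le_iff]
  intro x y h
  obtain ⟨z, h1, h2⟩ := entry_mul_ne_zero h
  exact (edist_triangle x z y).trans (add_le_add (edist_le_propagation h1)
    (edist_le_propagation h2))

theorem propagation_add_le (a b : ell2 X →L[ℂ] ell2 X) :
    propagation (a + b) ≤ max (propagation a) (propagation b) := by
  rw [propagation_le_iff]
  intro x y h
  by_cases ha : entry a x y = 0
  · have hb : entry b x y ≠ 0 := by
      intro hb
      apply h
      have : entry (a + b) x y = entry a x y + entry b x y := rfl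
      rw [this, ha, hb, add_zero]
    exact le_max_of_le_right (edist_le_propagation hb)
  · exact le_max_of_le_left (edist_le_propagation ha)

theorem propagation_star_le (a : ell2 X →L[ℂ] ell2 X) : propagation (star a) ≤ propagation a := by
  rw [propagation_le_iff]
  intro x y h
  rw [entry_star] at h
  rw [edist_comm]
  exact edist_le_propagation (star_ne_zero.1 h)

theorem propagation_algebraMap (c : ℂ) :
    propagation (algebraMap ℂ (ell2 X →L[ℂ] ell2 X) c) = 0 := by
  classical
  rw [← nonpos_iff_eq_zero, propagation_le_iff]
  intro x y h
  have hxy : x = y := by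
    by_contra hne
    apply h
    have : entry (algebraMap ℂ (ell2 X →L[ℂ] ell2 X) c) x y = c * (basisVec y : ell2 X) x := rfl
    rw [this, basisVec, lp.single_apply_ne _ _ _ hne, mul_zero]
  rw [hxy, edist_self]

end helpers

/-- The `*`-algebra of bounded operators on `ℓ₂(X)` with finite propagation. -/
def finitePropagation (X : Type*) [MetricSpace X] : StarSubalgebra ℂ (ell2 X →L[ℂ] ell2 X) where
  carrier := {a | propagation a < ⊤}
  mul_mem' {a b} ha hb := (propagation_mul_le a b).trans_lt (ENNReal.add_lt_top.2 ⟨ha, hb⟩)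
  add_mem' {a b} ha hb := (propagation_add_le a b).trans_lt (max_lt ha hb)
  algebraMap_mem' c := by
    exact (propagation_algebraMap c).trans_lt ENNReal.zero_lt_top
  star_mem' {a} ha := (propagation_star_le a).trans_lt ha

/-- The uniform Roe algebra `C*_u(X)`: the operator-norm closure of the `*`-algebra of bounded
operators on `ℓ₂(X)` with finite propagation, a C*-subalgebra of the bounded operators. -/
def uniformRoeAlgebra (X : Type*) [MetricSpace X] : StarSubalgebra ℂ (ell2 X →L[ℂ] ell2 X) :=
  (finitePropagation X).topologicalClosure

end UniformRoe

end

noncomputable section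

namespace UniformRoe

/-! ### Truncations, matrix units and approximation by finite propagation -/

section ell2

variable {X : Type*}

/-! An isomorphism `Φ` carries the matrix units of `X` to matrix units of an orthonormal basis of
`ell2 Y`, so it is conjugation by a unitary `U` (`exists_unitary`). It remains to read a map `f : X
→ Y` off `U`, by letting `f x` be a point where `U δ_x` is not small.

Two facts make this work. A Baire category argument on the cube of subsets of `X` gives one radius
that controls the columns of `U 1_A U⁻¹` for all `A` at once (`exists_radius_conjBy_restr`). Large
entries then exist: if all entries `(U δ_x)(y)` were small for some `y`, signs could be chosen on
the rank-one pieces `U e_xx U⁻¹ δ_y` so that their sum is small near `y`. This sum is nearly a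
reflection applied to the unit vector `δ_y`, and its tail is controlled by the uniform radius, a
contradiction (`exists_lower_bound`).

Hence `U δ_x` is concentrated around `f x`, uniformly in `x`. Testing `U` on one adjacency operator
for each scale shows that `f` is coarse, and the same construction for `U⁻¹` gives the coarse
inverse. -/

theorem basisVec_apply_self (x : X) : (basisVec x : ell2 X) x = 1 := by
  classical
  rw [basisVec, lp.single_apply_self]

theorem basisVec_apply_of_ne {x y : X} (h : y ≠ x) : (basisVec x : ell2 X) y = 0 := by
  classical
  rw [basisVec, lp.single_apply_ne _ _ _ h]

theorem norm_basisVec (x : X) : ‖(basisVec x : ell2 X)‖ = 1 := by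
  classical
  rw [basisVec, lp.norm_single (by norm_num)]
  simp

theorem norm_apply_le (v : ell2 X) (x : X) : ‖v x‖ ≤ ‖v‖ :=
  lp.norm_apply_le_norm two_ne_zero v x

theorem hasSum_norm_sq (v : ell2 X) : HasSum (fun x => ‖v x‖ ^ 2) (‖v‖ ^ 2) := by
  have := lp.hasSum_norm (p := 2) (by norm_num) v
  simpa using this

theorem sum_norm_sq_le (v : ell2 X) (s : Finset X) : ∑ x ∈ s, ‖v x‖ ^ 2 ≤ ‖v‖ ^ 2 :=
  sum_le_hasSum s (fun _ _ => by positivity) (hasSum_norm_sq v)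

theorem norm_le_of_forall_sum_sq_le {v : ell2 X} {C : ℝ} (hC : 0 ≤ C)
    (h : ∀ s : Finset X, ∑ x ∈ s, ‖v x‖ ^ 2 ≤ C ^ 2) : ‖v‖ ≤ C :=
  lp.norm_le_of_forall_sum_le (p := 2) (by norm_num) hC (by simpa using h)

theorem memℓp_of_forall_sum_sq_le {v : X → ℂ} (C : ℝ)
    (h : ∀ s : Finset X, ∑ x ∈ s, ‖v x‖ ^ 2 ≤ C) : Memℓp v 2 :=
  memℓp_gen' (C := C) (by simpa using h)

theorem norm_le_norm_of_forall {v w : ell2 X} (h : ∀ x, ‖v x‖ ≤ ‖w x‖) : ‖v‖ ≤ ‖w‖ :=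
  norm_le_of_forall_sum_sq_le (norm_nonneg _) fun s =>
    (Finset.sum_le_sum fun x _ => by gcongr; exact h x).trans (sum_norm_sq_le w s)

theorem norm_eq_norm_of_forall {v w : ell2 X} (h : ∀ x, ‖v x‖ = ‖w x‖) : ‖v‖ = ‖w‖ :=
  (norm_le_norm_of_forall fun x => (h x).le).antisymm
    (norm_le_norm_of_forall fun x => (h x).ge)

theorem hasSum_smul_basisVec (v : ell2 X) : HasSum (fun x => v x • basisVec x) v := by
  classical
  convert lp.hasSum_single (p := 2) (by norm_num) v using 2 with x
  rw [basisVec, ← lp.single_smul, smul_eq_mul, mul_one]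

theorem ext_basisVec {E : Type*} [NormedAddCommGroup E] [NormedSpace ℂ E]
    {S T : ell2 X →L[ℂ] E} (h : ∀ x, S (basisVec x) = T (basisVec x)) : S = T := by
  ext1 v
  have h1 := (hasSum_smul_basisVec v).mapL S
  have h2 := (hasSum_smul_basisVec v).mapL T
  simp only [map_smul, h] at h1 h2
  exact h1.unique h2

/-- The orthogonal projection of `ℓ₂(X)` onto the vectors supported on `A`. -/
def restr (A : Set X) : ell2 X →L[ℂ] ell2 X :=
  LinearMap.mkContinuous
    { toFun := fun v => ⟨A.indicator v, memℓp_of_forall_sum_sq_le (‖v‖ ^ 2) fun s =>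
        (Finset.sum_le_sum fun x _ => by gcongr; exact norm_indicator_le_norm_self _ _).trans
          (sum_norm_sq_le v s)⟩
      map_add' := fun v w => by
        ext x; exact congrFun (Set.indicator_add A (v : X → ℂ) w) x
      map_smul' := fun c v => by
        ext x; exact congrFun (Set.indicator_const_smul A c (v : X → ℂ)) x }
    1 fun v => by
      rw [one_mul]
      exact norm_le_norm_of_forall fun x => norm_indicator_le_norm_self _ _

theorem restr_apply_of_mem {A : Set X} {x : X} (h : x ∈ A) (v : ell2 X) : restr A v x = v x :=
  Set.indicator_of_mem h _

theorem restr_apply_of_notMem {A : Set X} {x : X} (h : x ∉ A) (v : ell2 X) : restr A v x = 0 :=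
  Set.indicator_of_notMem h _

theorem restr_apply_eq_zero (A : Set X) {v : ell2 X} {x : X} (h : v x = 0) : restr A v x = 0 := by
  by_cases hx : x ∈ A
  · rw [restr_apply_of_mem hx, h]
  · rw [restr_apply_of_notMem hx]

theorem norm_restr_le (A : Set X) (v : ell2 X) : ‖restr A v‖ ≤ ‖v‖ :=
  norm_le_norm_of_forall fun _ => norm_indicator_le_norm_self _ _

theorem norm_sub_restr_le (A : Set X) (v : ell2 X) : ‖v - restr A v‖ ≤ ‖v‖ := by
  refine norm_le_norm_of_forall fun x => ?_
  change ‖v x - restr A v x‖ ≤ _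
  by_cases h : x ∈ A
  · simp [restr_apply_of_mem h]
  · simp [restr_apply_of_notMem h]

theorem norm_sub_restr_anti {A B : Set X} (hAB : A ⊆ B) (v : ell2 X) :
    ‖v - restr B v‖ ≤ ‖v - restr A v‖ := by
  refine norm_le_norm_of_forall fun x => ?_
  change ‖v x - restr B v x‖ ≤ ‖v x - restr A v x‖
  by_cases h : x ∈ B
  · simp [restr_apply_of_mem h]
  · rw [restr_apply_of_notMem h, restr_apply_of_notMem fun h' => h (hAB h')]

theorem norm_two_smul_restr_sub (A : Set X) (v : ell2 X) :
    ‖(2 : ℂ) • restr A v - v‖ = ‖v‖ := by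
  refine norm_eq_norm_of_forall fun x => ?_
  change ‖2 * restr A v x - v x‖ = _
  by_cases h : x ∈ A
  · rw [restr_apply_of_mem h]; congr 1; ring
  · rw [restr_apply_of_notMem h]; simp

theorem restr_basisVec_of_mem {A : Set X} {x : X} (h : x ∈ A) :
    restr A (basisVec x) = basisVec x := by
  ext z
  by_cases hz : z = x
  · rw [hz, restr_apply_of_mem h]
  · rw [restr_apply_eq_zero A (basisVec_apply_of_ne hz), basisVec_apply_of_ne hz]

theorem restr_basisVec_of_notMem {A : Set X} {x : X} (h : x ∉ A) :
    restr A (basisVec x) = 0 := by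
  ext z
  by_cases hz : z = x
  · rw [hz, restr_apply_of_notMem h]; rfl
  · exact restr_apply_eq_zero A (basisVec_apply_of_ne hz)

theorem restr_finset (F : Finset X) (v : ell2 X) : restr ↑F v = ∑ x ∈ F, v x • basisVec x := by
  classical
  have h := (hasSum_smul_basisVec v).mapL (restr (F : Set X))
  refine h.unique ?_
  have : ∑ x ∈ F, v x • basisVec x = ∑ x ∈ F, restr (F : Set X) (v x • basisVec x) := by
    refine Finset.sum_congr rfl fun x hx => ?_
    rw [map_smul, restr_basisVec_of_mem (Finset.mem_coe.2 hx)]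
  rw [this]
  refine hasSum_sum_of_ne_finset_zero fun x hx => ?_
  rw [map_smul, restr_basisVec_of_notMem (by simpa using hx), smul_zero]

/-- The operator `v ↦ v y • δ_x`. -/
def matrixUnit (x y : X) : ell2 X →L[ℂ] ell2 X :=
  (innerSL ℂ (basisVec y)).smulRight (basisVec x)

theorem matrixUnit_apply (x y : X) (v : ell2 X) : matrixUnit x y v = v y • basisVec x := by
  rw [matrixUnit, ContinuousLinearMap.smulRight_apply, innerSL_apply_apply, inner_basisVec]

theorem star_matrixUnit (x y : X) : star (matrixUnit x y) = matrixUnit y x := by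
  rw [ContinuousLinearMap.star_eq_adjoint, eq_comm, ContinuousLinearMap.eq_adjoint_iff]
  intro v w
  rw [matrixUnit_apply, matrixUnit_apply, inner_smul_left, inner_smul_right, inner_basisVec,
    ← inner_conj_symm, inner_basisVec, mul_comm]

theorem matrixUnit_mul_mul (a : ell2 X →L[ℂ] ell2 X) (x y z w : X) :
    matrixUnit x y * a * matrixUnit z w = entry a y z • matrixUnit x w := by
  ext1 v
  simp only [mul_apply_eq_comp, smul_apply, matrixUnit_apply, map_smul, entry]
  rw [smul_comm]

theorem matrixUnit_mul_self (x y w : X) :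
    matrixUnit x y * matrixUnit y w = matrixUnit x w := by
  have := matrixUnit_mul_mul 1 x y y w
  rw [mul_one] at this
  rw [this]
  simp [entry, basisVec_apply_self]

theorem matrixUnit_mul_of_ne (x w : X) {y z : X} (h : y ≠ z) :
    matrixUnit x y * matrixUnit z w = 0 := by
  have := matrixUnit_mul_mul 1 x y z w
  rw [mul_one] at this
  rw [this]
  simp [entry, basisVec_apply_of_ne h]

/-- The operator whose matrix is the indicator function of a symmetric relation with rows of
cardinality at most `N`. -/
theorem exists_operator_of_bounded_rows {S : X → Finset X} (hS : ∀ x z, z ∈ S x ↔ x ∈ S z) {N : ℕ}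
    (hN : ∀ x, (S x).card ≤ N) :
    ∃ T : ell2 X →L[ℂ] ell2 X, ∀ v x, T v x = ∑ z ∈ S x, v z := by
  classical
  have key : ∀ (v : ell2 X) (s : Finset X),
      ∑ x ∈ s, ‖∑ z ∈ S x, v z‖ ^ 2 ≤ (N * ‖v‖) ^ 2 := by
    intro v s
    calc ∑ x ∈ s, ‖∑ z ∈ S x, v z‖ ^ 2
        ≤ ∑ x ∈ s, N * ∑ z ∈ S x, ‖v z‖ ^ 2 := by
          refine Finset.sum_le_sum fun x _ => ?_
          calc ‖∑ z ∈ S x, v z‖ ^ 2 ≤ (∑ z ∈ S x, ‖v z‖) ^ 2 := by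
                gcongr; exact norm_sum_le _ _
            _ ≤ (S x).card * ∑ z ∈ S x, ‖v z‖ ^ 2 := sq_sum_le_card_mul_sum_sq
            _ ≤ N * ∑ z ∈ S x, ‖v z‖ ^ 2 := by
                gcongr
                exact hN x
      _ = N * ∑ z ∈ s.biUnion S, ∑ x ∈ s with z ∈ S x, ‖v z‖ ^ 2 := by
          rw [← Finset.mul_sum]
          congr 1
          refine Finset.sum_comm' fun x z => ?_
          simp only [Finset.mem_filter, Finset.mem_biUnion]
          exact ⟨fun h => ⟨h, x, h⟩, fun h => h.1⟩
      -- By symmetry of `S`, each `z` lies in at most `N` of the sets `S x`.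
      _ ≤ N * ∑ z ∈ s.biUnion S, N * ‖v z‖ ^ 2 := by
          gcongr with z
          rw [Finset.sum_const, nsmul_eq_mul]
          gcongr
          refine (Finset.card_le_card fun x hx => ?_).trans (hN z)
          exact (hS x z).1 (Finset.mem_filter.1 hx).2
      _ ≤ N * (N * ‖v‖ ^ 2) := by
          rw [← Finset.mul_sum]
          gcongr
          exact sum_norm_sq_le v _
      _ = (N * ‖v‖) ^ 2 := by ring
  refine ⟨LinearMap.mkContinuous
    { toFun := fun v => ⟨fun x => ∑ z ∈ S x, v z, memℓp_of_forall_sum_sq_le _ (key v)⟩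
      map_add' := fun v w => by
        ext x
        exact Finset.sum_add_distrib
      map_smul' := fun c v => by
        ext x
        exact (Finset.mul_sum _ _ _).symm } N fun v =>
      norm_le_of_forall_sum_sq_le (by positivity) (key v), fun v x => rfl⟩

theorem inner_apply_eq_zero (b : ell2 X →L[ℂ] ell2 X) {P Q : Set X}
    (h : ∀ z ∈ P, ∀ w ∈ Q, entry b z w = 0) (v u : ell2 X) :
    inner ℂ (restr P v) (b (restr Q u)) = 0 := by
  have key : ∀ z ∈ P, b (restr Q u) z = 0 := by
    intro z hz
    rw [← inner_basisVec, ← ContinuousLinearMap.adjoint_inner_left, lp.inner_eq_tsum]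
    refine (tsum_congr fun w => ?_).trans tsum_zero
    by_cases hw : w ∈ Q
    · have h1 : ContinuousLinearMap.adjoint b (basisVec z) w = star (entry b z w) :=
        entry_star b w z
      rw [h1, h z hz w hw]
      simp
    · rw [restr_apply_of_notMem hw, inner_zero_right]
  rw [lp.inner_eq_tsum]
  refine (tsum_congr fun z => ?_).trans tsum_zero
  by_cases hz : z ∈ P
  · rw [key z hz, inner_zero_right]
  · rw [restr_apply_of_notMem hz, inner_zero_left]

variable [MetricSpace X]

theorem mem_finitePropagation {a : ell2 X →L[ℂ] ell2 X} (c : ℝ)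
    (h : ∀ x y, entry a x y ≠ 0 → dist x y ≤ c) : a ∈ finitePropagation X := by
  refine lt_of_le_of_lt ((propagation_le_iff a (ENNReal.ofReal c)).2 fun x y hxy => ?_)
    ENNReal.ofReal_lt_top
  rw [edist_dist]
  exact ENNReal.ofReal_le_ofReal (h x y hxy)

theorem exists_dist_le {a : ell2 X →L[ℂ] ell2 X} (ha : a ∈ finitePropagation X) :
    ∃ c : ℝ, 0 ≤ c ∧ ∀ x y, entry a x y ≠ 0 → dist x y ≤ c := by
  refine ⟨(propagation a).toReal, ENNReal.toReal_nonneg, fun x y h => ?_⟩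
  rw [dist_edist]
  exact ENNReal.toReal_mono (LT.lt.ne ha) (edist_le_propagation h)

theorem finitePropagation_le : finitePropagation X ≤ uniformRoeAlgebra X :=
  StarSubalgebra.le_topologicalClosure _

theorem exists_finitePropagation_near {a : ell2 X →L[ℂ] ell2 X} (ha : a ∈ uniformRoeAlgebra X)
    {ε : ℝ} (hε : 0 < ε) : ∃ b ∈ finitePropagation X, ‖a - b‖ < ε := by
  have ha' : a ∈ closure (finitePropagation X : Set (ell2 X →L[ℂ] ell2 X)) := ha
  obtain ⟨b, hb, h⟩ := Metric.mem_closure_iff.1 ha' ε hε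
  exact ⟨b, hb, by rwa [← dist_eq_norm]⟩

theorem restr_mem (A : Set X) : restr A ∈ uniformRoeAlgebra X := by
  refine finitePropagation_le (mem_finitePropagation 0 fun x y h => ?_)
  by_contra hne
  have hxy : x ≠ y := fun e => hne (by rw [e, dist_self])
  exact h (restr_apply_eq_zero A (basisVec_apply_of_ne hxy))

theorem matrixUnit_mem (x y : X) : matrixUnit x y ∈ uniformRoeAlgebra X := by
  refine finitePropagation_le (mem_finitePropagation (dist x y) fun z w h => ?_)
  rw [entry, matrixUnit_apply] at h
  have h1 : y = w := by
    by_contra hne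
    exact h (by rw [basisVec_apply_of_ne hne, zero_smul]; rfl)
  have h2 : z = x := by
    by_contra hne
    refine h ?_
    change _ * _ = (0 : ℂ)
    rw [basisVec_apply_of_ne hne, mul_zero]
  rw [h1, h2]

theorem exists_ball_finset (hX : UniformlyLocallyFinite X) (r : ℝ) :
    ∃ N : ℕ, ∃ S : X → Finset X, (∀ x, (S x).card ≤ N) ∧ ∀ x z, z ∈ S x ↔ dist x z ≤ r := by
  obtain ⟨N, hN⟩ := hX (max r 1) (by positivity)
  have hN' : ∀ x : X, (Metric.closedBall x r).encard ≤ N := fun x =>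
    (Set.encard_le_encard (Metric.closedBall_subset_closedBall (le_max_left _ _))).trans (hN x)
  have hfin : ∀ x : X, (Metric.closedBall x r).Finite := fun x =>
    Set.finite_of_encard_le_coe (hN' x)
  refine ⟨N, fun x => (hfin x).toFinset, fun x => ?_, fun x z => ?_⟩
  · have := hN' x
    rw [(hfin x).encard_eq_coe_toFinset_card] at this
    exact_mod_cast this
  · rw [Set.Finite.mem_toFinset, Metric.mem_closedBall, dist_comm]

/-- One operator detects all pairs at distance at most `r`; the uniform bound on balls makes it
bounded. -/
theorem exists_adjacency_operator (hX : UniformlyLocallyFinite X) (r : ℝ) :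
    ∃ a ∈ uniformRoeAlgebra X, ∀ x x', dist x x' ≤ r → entry a x x' = 1 := by
  obtain ⟨N, S, hN, hS⟩ := exists_ball_finset hX r
  obtain ⟨T, hT⟩ := exists_operator_of_bounded_rows
    (fun x z => by rw [hS, hS, dist_comm]) hN
  refine ⟨T, finitePropagation_le (mem_finitePropagation r fun x y h => ?_), fun x y h => ?_⟩
  · by_contra hne
    refine h ?_
    rw [entry, hT]
    refine Finset.sum_eq_zero fun z hz => basisVec_apply_of_ne ?_
    rintro rfl
    exact hne ((hS _ _).1 hz)
  · rw [entry, hT, Finset.sum_eq_single_of_mem y ((hS _ _).2 h), basisVec_apply_self]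
    exact fun z _ hz => basisVec_apply_of_ne hz

/-- A finite-propagation approximant `b` has no tail, so the tail of a column of `a` is that of `a -
b`. -/
theorem exists_radius_column {a : ell2 X →L[ℂ] ell2 X} (ha : a ∈ uniformRoeAlgebra X) {ε : ℝ}
    (hε : 0 < ε) : ∃ r : ℝ, ∀ y,
      ‖a (basisVec y) - restr (Metric.closedBall y r) (a (basisVec y))‖ ≤ ε := by
  obtain ⟨b, hb, hab⟩ := exists_finitePropagation_near ha hε
  obtain ⟨c, -, hc⟩ := exists_dist_le hb
  refine ⟨c, fun y => ?_⟩
  have hby : restr (Metric.closedBall y c) (b (basisVec y)) = b (basisVec y) := by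
    ext x
    by_cases hx : x ∈ Metric.closedBall y c
    · rw [restr_apply_of_mem hx]
    · rw [restr_apply_of_notMem hx]
      by_contra hne
      exact hx (hc x y (Ne.symm hne))
  have : a (basisVec y) - restr (Metric.closedBall y c) (a (basisVec y)) =
      (a - b) (basisVec y) - restr (Metric.closedBall y c) ((a - b) (basisVec y)) := by
    rw [sub_apply, map_sub, hby]
    abel
  rw [this]
  refine (norm_sub_restr_le _ _).trans (((a - b).le_opNorm _).trans ?_)
  rw [norm_basisVec, mul_one]
  exact hab.le

end ell2

/-! ### Balancing signs in a Hilbert space -/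

section signs

variable {ι E : Type*} [NormedAddCommGroup E] [InnerProductSpace ℂ E]

/-- Signs are chosen greedily: by the parallelogram law, `‖w + v‖²` and `‖w - v‖²` have mean `‖w‖² +
‖v‖²`, so one of them does not exceed it. -/
theorem exists_signs_norm_sq_le [DecidableEq ι] (v : ι → E) (F : Finset ι) :
    ∃ A ⊆ F, ‖∑ x ∈ A, v x - ∑ x ∈ F \ A, v x‖ ^ 2 ≤ ∑ x ∈ F, ‖v x‖ ^ 2 := by
  induction F using Finset.induction_on with
  | empty => exact ⟨∅, subset_rfl, by simp⟩
  | insert i F hi ih =>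
    obtain ⟨A, hA, h⟩ := ih
    have hiA : i ∉ A := fun h' => hi (hA h')
    set w := ∑ x ∈ A, v x - ∑ x ∈ F \ A, v x with hw
    have hpl : ‖w + v i‖ ^ 2 + ‖w - v i‖ ^ 2 = 2 * (‖w‖ ^ 2 + ‖v i‖ ^ 2) := by
      have := parallelogram_law_with_norm ℂ w (v i)
      nlinarith
    rw [Finset.sum_insert hi]
    by_cases hle : ‖w + v i‖ ^ 2 ≤ ‖w‖ ^ 2 + ‖v i‖ ^ 2
    · refine ⟨insert i A, Finset.insert_subset_insert _ hA, ?_⟩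
      have h1 : insert i F \ insert i A = F \ A := by
        rw [Finset.insert_sdiff_insert, Finset.sdiff_insert_of_notMem hi]
      rw [Finset.sum_insert hiA, h1]
      have h2 : v i + ∑ x ∈ A, v x - ∑ x ∈ F \ A, v x = w + v i := by rw [hw]; abel
      rw [h2]
      linarith
    · refine ⟨A, hA.trans (Finset.subset_insert _ _), ?_⟩
      rw [Finset.insert_sdiff_of_notMem _ hiA,
        Finset.sum_insert (fun h' => hi (Finset.mem_sdiff.1 h').1)]
      have h2 : ∑ x ∈ A, v x - (v i + ∑ x ∈ F \ A, v x) = w - v i := by rw [hw]; abel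
      rw [h2]
      linarith

end signs

/-! ### Uniform approximation and large entries for a spatial embedding -/

section spatial

variable {X Y : Type*}

/-- The operator `U a U⁻¹`. -/
def conjBy (U : ell2 X ≃ₗᵢ[ℂ] ell2 Y) (a : ell2 X →L[ℂ] ell2 X) : ell2 Y →L[ℂ] ell2 Y :=
  (U : ell2 X →L[ℂ] ell2 Y) ∘L a ∘L (U.symm : ell2 Y →L[ℂ] ell2 X)

theorem conjBy_apply (U : ell2 X ≃ₗᵢ[ℂ] ell2 Y) (a : ell2 X →L[ℂ] ell2 X) (v : ell2 Y) :
    conjBy U a v = U (a (U.symm v)) := rfl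

theorem symm_basisVec_apply (U : ell2 X ≃ₗᵢ[ℂ] ell2 Y) (x : X) (y : Y) :
    U.symm (basisVec y) x = star (U (basisVec x) y) := by
  rw [← inner_basisVec, ← inner_basisVec, ← U.inner_map_map, U.apply_symm_apply]
  exact (inner_conj_symm _ _).symm

/-- A uniform limit of functions of finitely many coordinates. It makes the sets in the Baire
argument closed. -/
theorem continuous_restr (v : ell2 X) :
    Continuous fun s : X → Bool => restr {x | s x = true} v := by
  have hu : TendstoUniformly
      (fun (F : Finset X) (s : X → Bool) => restr {x | s x = true} (∑ x ∈ F, v x • basisVec x))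
      (fun s => restr {x | s x = true} v) Filter.atTop := by
    rw [Metric.tendstoUniformly_iff]
    intro ε hε
    have h := Metric.tendsto_nhds.1 (hasSum_smul_basisVec v) ε hε
    filter_upwards [h] with F hF s
    rw [dist_comm, dist_eq_norm, ← map_sub]
    rw [dist_eq_norm] at hF
    exact (norm_restr_le _ _).trans_lt hF
  refine hu.continuous (Filter.Frequently.of_forall fun F => ?_)
  simp only [map_sum, map_smul]
  refine continuous_finsetSum _ fun x _ => ?_
  have : (fun s : X → Bool => restr {x | s x = true} (basisVec x)) =
      (fun c : Bool => if c then basisVec x else (0 : ell2 X)) ∘ fun s => s x := by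
    funext s
    by_cases hs : s x = true
    · rw [restr_basisVec_of_mem (by exact hs)]
      simp [hs]
    · rw [restr_basisVec_of_notMem (by exact hs)]
      simp [hs]
  have hc : Continuous fun s : X → Bool => restr {x | s x = true} (basisVec x) := by
    rw [this]
    exact continuous_of_discreteTopology.comp (continuous_apply x)
  exact hc.const_smul (v x)

theorem conjBy_restr_singleton (U : ell2 X ≃ₗᵢ[ℂ] ell2 Y) (x : X) (y : Y) :
    conjBy U (restr {x}) (basisVec y) = star (U (basisVec x) y) • U (basisVec x) := by
  have := restr_finset {x} (U.symm (basisVec y))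
  rw [Finset.coe_singleton, Finset.sum_singleton] at this
  rw [conjBy_apply, this, map_smul, symm_basisVec_apply]

theorem conjBy_restr_finset (U : ell2 X ≃ₗᵢ[ℂ] ell2 Y) (F : Finset X) (y : Y) :
    conjBy U (restr F) (basisVec y) = ∑ x ∈ F, star (U (basisVec x) y) • U (basisVec x) := by
  rw [conjBy_apply, restr_finset, map_sum]
  simp only [map_smul, symm_basisVec_apply]

theorem norm_restr_finset_sq (S : Finset Y) (v : ell2 Y) :
    ‖restr (S : Set Y) v‖ ^ 2 = ∑ z ∈ S, ‖v z‖ ^ 2 := by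
  refine (hasSum_norm_sq (restr (S : Set Y) v)).unique ?_
  have : ∑ z ∈ S, ‖v z‖ ^ 2 = ∑ z ∈ S, ‖restr (S : Set Y) v z‖ ^ 2 :=
    Finset.sum_congr rfl fun z hz => by rw [restr_apply_of_mem (Finset.mem_coe.2 hz)]
  rw [this]
  refine hasSum_sum_of_ne_finset_zero fun z hz => ?_
  rw [restr_apply_of_notMem (by simpa using hz)]
  simp

theorem sum_norm_apply_sq_le (U : ell2 X ≃ₗᵢ[ℂ] ell2 Y) (F : Finset X) (y : Y) :
    ∑ x ∈ F, ‖U (basisVec x) y‖ ^ 2 ≤ 1 := by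
  have h := sum_norm_sq_le (U.symm (basisVec y)) F
  rw [U.symm.norm_map, norm_basisVec, one_pow] at h
  simpa [symm_basisVec_apply] using h

variable [MetricSpace X] [MetricSpace Y]

/-- Conjugation by `U` maps `C*_u(X)` into `C*_u(Y)`. -/
def MapsRoe (U : ell2 X ≃ₗᵢ[ℂ] ell2 Y) : Prop :=
  ∀ a ∈ uniformRoeAlgebra X, conjBy U a ∈ uniformRoeAlgebra Y

theorem norm_sub_restr_mono {y : Y} {r R : ℝ} (h : r ≤ R) (v : ell2 Y) :
    ‖v - restr (Metric.closedBall y R) v‖ ≤ ‖v - restr (Metric.closedBall y r) v‖ :=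
  norm_sub_restr_anti (Metric.closedBall_subset_closedBall h) v

/-- Equi-approximability of the images of the diagonal projections. -/
theorem exists_radius_conjBy_restr {U : ell2 X ≃ₗᵢ[ℂ] ell2 Y} (hU : MapsRoe U) {ε : ℝ}
    (hε : 0 < ε) : ∃ R : ℝ, ∀ (A : Set X) (y : Y),
      ‖conjBy U (restr A) (basisVec y) -
        restr (Metric.closedBall y R) (conjBy U (restr A) (basisVec y))‖ ≤ ε := by
  classical
  have hcol : ∀ A : Set X, ∃ r : ℝ, ∀ y, ‖conjBy U (restr A) (basisVec y) -
        restr (Metric.closedBall y r) (conjBy U (restr A) (basisVec y))‖ ≤ ε / 3 := fun A =>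
    exists_radius_column (hU _ (restr_mem A)) (by positivity)
  choose r hr using hcol
  set D : ℕ → Set (X → Bool) := fun n => {s | ∀ y,
    ‖conjBy U (restr {x | s x = true}) (basisVec y) -
      restr (Metric.closedBall y n) (conjBy U (restr {x | s x = true}) (basisVec y))‖ ≤ ε / 3}
    with hD
  have hclosed : ∀ n, IsClosed (D n) := by
    intro n
    simp only [hD, Set.ofPred_forall]
    refine isClosed_iInter fun y => isClosed_le ?_ continuous_const
    have h1 : Continuous fun s : X → Bool => conjBy U (restr {x | s x = true}) (basisVec y) :=
      U.continuous.comp (continuous_restr (U.symm (basisVec y)))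
    exact (h1.sub ((restr _).continuous.comp h1)).norm
  have hcover : ⋃ n, D n = Set.univ := by
    refine Set.eq_univ_of_forall fun s => Set.mem_iUnion.2 ?_
    obtain ⟨n, hn⟩ := exists_nat_ge (r {x | s x = true})
    exact ⟨n, fun y => (norm_sub_restr_mono hn _).trans (hr _ y)⟩
  -- Baire: some `D n` contains every subset that agrees with `s₀` on a finite set `I`.
  obtain ⟨n, s₀, hs₀⟩ := nonempty_interior_of_iUnion_of_closed hclosed hcover
  obtain ⟨I, u, hu, hsub⟩ := isOpen_pi_iff.1 isOpen_interior s₀ hs₀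
  -- The finitely many subsets of `I` have a common radius.
  obtain ⟨M, hM⟩ := (I.powerset.image fun J : Finset X => r (J : Set X)).exists_le
  have hfin : ∀ J : Set X, J ⊆ I → ∀ y, ‖conjBy U (restr J) (basisVec y) -
        restr (Metric.closedBall y (max n M)) (conjBy U (restr J) (basisVec y))‖ ≤ ε / 3 := by
    intro J hJ y
    obtain ⟨J', rfl⟩ := (I.finite_toSet.subset hJ).exists_finset_coe
    refine (norm_sub_restr_mono ?_ _).trans (hr _ y)
    exact (hM _ (Finset.mem_image_of_mem _
      (Finset.mem_powerset.2 (Finset.coe_subset.1 hJ)))).trans (le_max_right _ _)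
  refine ⟨max n M, fun A y => ?_⟩
  -- Altering `A` on `I` only puts it in `D n`; the error consists of two subsets of `I`, hence the
  -- three tolerances `ε / 3`.
  set s : X → Bool := fun x => if x ∈ I then s₀ x else decide (x ∈ A) with hs
  set A' : Set X := {x | s x = true} with hA'
  have hsD : s ∈ D n := interior_subset (hsub fun x hx => by
    have : s x = s₀ x := if_pos hx
    rw [this]
    exact (hu x hx).2)
  have hsplit : restr A = restr A' + restr (A ∩ I) - restr (A' ∩ I) := by
    ext v x
    change A.indicator (v : X → ℂ) x = A'.indicator (v : X → ℂ) x +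
      (A ∩ I).indicator (v : X → ℂ) x - (A' ∩ I).indicator (v : X → ℂ) x
    by_cases hxI : x ∈ I
    · simp [Set.indicator_apply, hxI]
    · have : x ∈ A' ↔ x ∈ A := by simp [hA', hs, hxI]
      simp [Set.indicator_apply, hxI, this]
  set χ := restr (Metric.closedBall y (max (n : ℝ) M))
  have h1 : ‖conjBy U (restr A') (basisVec y) - χ (conjBy U (restr A') (basisVec y))‖ ≤ ε / 3 :=
    (norm_sub_restr_mono (le_max_left _ _) _).trans (hsD y)
  have h2 := hfin (A ∩ I) Set.inter_subset_right y
  have h3 := hfin (A' ∩ I) Set.inter_subset_right y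
  have heq : conjBy U (restr A) (basisVec y) = conjBy U (restr A') (basisVec y) +
      conjBy U (restr (A ∩ I)) (basisVec y) - conjBy U (restr (A' ∩ I)) (basisVec y) := by
    simp only [conjBy_apply, hsplit, sub_apply, add_apply, map_sub, map_add]
  rw [heq, map_sub, map_add]
  calc _ = ‖(conjBy U (restr A') (basisVec y) - χ (conjBy U (restr A') (basisVec y))) +
        (conjBy U (restr (A ∩ I)) (basisVec y) - χ (conjBy U (restr (A ∩ I)) (basisVec y))) -
        (conjBy U (restr (A' ∩ I)) (basisVec y) -
          χ (conjBy U (restr (A' ∩ I)) (basisVec y)))‖ := by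
        congr 1; abel
    _ ≤ ε / 3 + ε / 3 + ε / 3 :=
        (norm_sub_le _ _).trans (add_le_add ((norm_add_le _ _).trans (add_le_add h1 h2)) h3)
    _ = ε := by ring

/-- The columns of `U⁻¹` are uniformly bounded below in the supremum norm. -/
theorem exists_lower_bound (hY : UniformlyLocallyFinite Y) {U : ell2 X ≃ₗᵢ[ℂ] ell2 Y}
    (hU : MapsRoe U) : ∃ δ : ℝ, 0 < δ ∧ ∀ y, ∃ x, δ ≤ ‖U (basisVec x) y‖ := by
  classical
  obtain ⟨R, hR⟩ := exists_radius_conjBy_restr hU (ε := 1 / 8) (by norm_num)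
  obtain ⟨N, S, hN, hS⟩ := exists_ball_finset hY R
  -- Chosen so that `δ² N ≤ (1 / 8)²`.
  refine ⟨1 / (8 * (N + 1)), by positivity, fun y => ?_⟩
  by_contra! hsmall
  set δ : ℝ := 1 / (8 * (N + 1)) with hδ
  have hball : Metric.closedBall y R = (S y : Set Y) := by
    ext z
    rw [Finset.mem_coe, hS, Metric.mem_closedBall, dist_comm]
  set χ := restr (S y : Set Y) with hχ
  set p : X → ell2 Y := fun x => star (U (basisVec x) y) • U (basisVec x) with hp
  -- The vectors `p x = U e_xx U⁻¹ δ_y` sum to `δ_y`.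
  obtain ⟨F, hF⟩ : ∃ F : Finset X, ‖∑ x ∈ F, p x - basisVec y‖ < 1 / 8 := by
    have h := (hasSum_smul_basisVec (U.symm (basisVec y))).mapL (U : ell2 X →L[ℂ] ell2 Y)
    have h' : HasSum p (basisVec y) := by
      convert h using 1
      · funext x
        simp [hp, symm_basisVec_apply]
      · simp
    obtain ⟨F, hF⟩ := (Metric.tendsto_nhds.1 h' (1 / 8) (by norm_num)).exists
    exact ⟨F, by rwa [dist_eq_norm] at hF⟩
  obtain ⟨A, hAF, hA⟩ := exists_signs_norm_sq_le (fun x => χ (p x)) F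
  have hsum : ∑ x ∈ F, ‖χ (p x)‖ ^ 2 ≤ δ ^ 2 * N := by
    calc ∑ x ∈ F, ‖χ (p x)‖ ^ 2
        ≤ ∑ x ∈ F, δ ^ 2 * ∑ z ∈ S y, ‖U (basisVec x) z‖ ^ 2 := by
          refine Finset.sum_le_sum fun x _ => ?_
          rw [hp]
          simp only
          rw [map_smul, norm_smul, norm_star, mul_pow, hχ, norm_restr_finset_sq]
          gcongr
          exact (hsmall x).le
      _ = δ ^ 2 * ∑ z ∈ S y, ∑ x ∈ F, ‖U (basisVec x) z‖ ^ 2 := by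
          rw [← Finset.mul_sum, Finset.sum_comm]
      _ ≤ δ ^ 2 * ∑ z ∈ S y, 1 := by
          gcongr with z
          exact sum_norm_apply_sq_le U F z
      _ ≤ δ ^ 2 * N := by
          rw [Finset.sum_const, nsmul_eq_mul, mul_one]
          gcongr
          exact hN y
  have hδN : δ ^ 2 * N ≤ (1 / 8) ^ 2 := by
    have h1 : δ * (N + 1) = 1 / 8 := by rw [hδ]; field_simp
    have h2 : (N : ℝ) ≤ (N + 1) ^ 2 := by nlinarith [(Nat.cast_nonneg N : (0 : ℝ) ≤ N)]
    calc δ ^ 2 * N ≤ δ ^ 2 * (N + 1) ^ 2 := by gcongr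
      _ = (1 / 8) ^ 2 := by rw [← mul_pow, h1]
  have hsign : ‖χ (∑ x ∈ A, p x) - χ (∑ x ∈ F \ A, p x)‖ ≤ 1 / 8 := by
    rw [map_sum, map_sum]
    exact le_of_sq_le_sq (hA.trans (hsum.trans hδN)) (by norm_num)
  set w := ∑ x ∈ A, p x with hw
  have hFw : ∑ x ∈ F, p x = ∑ x ∈ F \ A, p x + w := (Finset.sum_sdiff hAF).symm
  have hwp : conjBy U (restr A) (basisVec y) = w := conjBy_restr_finset U A y
  have htail : ‖w - χ w‖ ≤ 1 / 8 := by
    have := hR A y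
    rwa [hwp, hball] at this
  have hχy : χ (basisVec y) = basisVec y := by
    by_cases hR0 : 0 ≤ R
    · exact restr_basisVec_of_mem (Finset.mem_coe.2 ((hS y y).2 (by rwa [dist_self])))
    -- With `R < 0` the ball is empty, and `A = univ` would give `1 ≤ 1 / 8`.
    · exfalso
      have := hR Set.univ y
      rw [Metric.closedBall_eq_empty.2 (not_le.1 hR0)] at this
      have h1 : conjBy U (restr Set.univ) (basisVec y) = basisVec y := by
        have : restr (Set.univ : Set X) (U.symm (basisVec y)) = U.symm (basisVec y) := by
          ext x
          exact restr_apply_of_mem (Set.mem_univ x) _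
        rw [conjBy_apply, this, U.apply_symm_apply]
      have h2 : restr ∅ (basisVec y : ell2 Y) = 0 :=
        restr_basisVec_of_notMem (Set.notMem_empty y)
      rw [h1, h2, sub_zero, norm_basisVec] at this
      norm_num at this
  -- This vector is the unitary `U (2 · 1_A - 1) U⁻¹` applied to `δ_y`; the bounds above will force
  -- its norm to be at most `1 / 2`.
  have hiso : ‖(2 : ℂ) • w - basisVec y‖ = 1 := by
    rw [← hwp, conjBy_apply, ← map_smul]
    nth_rewrite 2 [← U.apply_symm_apply (basisVec y)]
    rw [← map_sub, U.norm_map, norm_two_smul_restr_sub, U.symm.norm_map, norm_basisVec]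
  have hdecomp : (2 : ℂ) • w - basisVec y = (2 : ℂ) • (w - χ w) +
      (χ w - χ (∑ x ∈ F \ A, p x)) + χ (∑ x ∈ F, p x - basisVec y) := by
    rw [map_sub, hχy, hFw, map_add, two_smul, two_smul]
    abel
  have : ‖(2 : ℂ) • w - basisVec y‖ ≤ 2 * (1 / 8) + 1 / 8 + 1 / 8 := by
    rw [hdecomp]
    refine (norm_add_le _ _).trans (add_le_add ((norm_add_le _ _).trans
      (add_le_add ?_ hsign)) ((norm_restr_le _ _).trans hF.le))
    rw [norm_smul]
    simpa using htail
  rw [hiso] at this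
  norm_num at this

end spatial

/-! ### From the unitary to a coarse equivalence -/

section rigidity

variable {X Y : Type*} [MetricSpace X] [MetricSpace Y]

/-- `U δ_x` is bounded below at `f x` and, uniformly in `x`, concentrated around `f x`. -/
def Localizes (U : ell2 X ≃ₗᵢ[ℂ] ell2 Y) (f : X → Y) : Prop :=
  (∃ δ : ℝ, 0 < δ ∧ ∀ x, δ ≤ ‖U (basisVec x) (f x)‖) ∧
    ∀ ε : ℝ, 0 < ε → ∃ R : ℝ, ∀ x,
      ‖U (basisVec x) - restr (Metric.closedBall (f x) R) (U (basisVec x))‖ ≤ ε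

/-- The lower bound for `U⁻¹` supplies `f`. Column `f x` of `U e_xx U⁻¹` is `U δ_x` times a scalar
of modulus at least `δ`, so a tail bound `δ * ε` for that column gives `ε` for `U δ_x`. -/
theorem exists_localizes (hX : UniformlyLocallyFinite X) {U : ell2 X ≃ₗᵢ[ℂ] ell2 Y}
    (hU : MapsRoe U) (hU' : MapsRoe U.symm) : ∃ f, Localizes U f := by
  obtain ⟨δ, hδ, h⟩ := exists_lower_bound hX hU'
  choose f hf using h
  have hlow : ∀ x, δ ≤ ‖U (basisVec x) (f x)‖ := by
    intro x
    have := hf x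
    rwa [symm_basisVec_apply, norm_star] at this
  refine ⟨f, ⟨δ, hδ, hlow⟩, fun ε hε => ?_⟩
  obtain ⟨R, hR⟩ := exists_radius_conjBy_restr hU (mul_pos hδ hε)
  refine ⟨R, fun x => ?_⟩
  have := hR {x} (f x)
  rw [conjBy_restr_singleton, map_smul, ← smul_sub, norm_smul, norm_star] at this
  exact le_of_mul_le_mul_left ((mul_le_mul_of_nonneg_right (hlow x) (norm_nonneg _)).trans this) hδ

/-- If `f x` and `f x'` were too far apart, a finite-propagation `b` close to `U a U⁻¹` could not
link the truncations of `U δ_x` and `U δ_x'`, although the entry `a_{xx'}` is `1`. -/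
theorem isCoarse_of_localizes (hX : UniformlyLocallyFinite X) {U : ell2 X ≃ₗᵢ[ℂ] ell2 Y}
    (hU : MapsRoe U) {f : X → Y} (hf : Localizes U f) : IsCoarse f := by
  intro r _
  obtain ⟨a, ha, ha1⟩ := exists_adjacency_operator hX r
  obtain ⟨b, hb, hab⟩ := exists_finitePropagation_near (hU a ha) (ε := 1 / 4) (by norm_num)
  obtain ⟨c, hc0, hc⟩ := exists_dist_le hb
  obtain ⟨R, hR⟩ := hf.2 (1 / (4 * (‖b‖ + 1))) (by positivity)
  set ε := 1 / (4 * (‖b‖ + 1)) with hε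
  have hεb : ε * ‖b‖ ≤ 1 / 4 := by
    rw [hε, div_mul_eq_mul_div, one_mul, div_le_div_iff₀ (by positivity) (by norm_num)]
    nlinarith [norm_nonneg b]
  refine ⟨max (2 * R + c) 1, by positivity, fun x x' hxx' => ?_⟩
  refine le_trans ?_ (le_max_left _ _)
  by_contra! hfar
  set ξ := U (basisVec x)
  set ξ' := U (basisVec x')
  set η := restr (Metric.closedBall (f x) R) ξ
  set η' := restr (Metric.closedBall (f x') R) ξ'
  have hξ : ‖ξ‖ = 1 := by rw [U.norm_map, norm_basisVec]
  have hξ' : ‖ξ'‖ = 1 := by rw [U.norm_map, norm_basisVec]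
  have hη : ‖η‖ ≤ 1 := (norm_restr_le _ _).trans hξ.le
  have h0 : inner ℂ η (b η') = 0 := by
    refine inner_apply_eq_zero b (fun z hz w hw => ?_) ξ ξ'
    by_contra hne
    have h1 := hc z w hne
    rw [Metric.mem_closedBall] at hz hw
    have h2 := dist_triangle4 (f x) z w (f x')
    rw [dist_comm (f x) z] at h2
    linarith
  have h1 : inner ℂ ξ (conjBy U a ξ') = 1 := by
    rw [conjBy_apply, U.symm_apply_apply, U.inner_map_map, inner_basisVec]
    exact ha1 x x' hxx'
  have hsplit : (1 : ℂ) = inner ℂ ξ ((conjBy U a - b) ξ') + inner ℂ (ξ - η) (b ξ') +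
      inner ℂ η (b (ξ' - η')) := by
    rw [← h1, sub_apply, map_sub, inner_sub_right, inner_sub_right, inner_sub_left, h0]
    ring
  have hb1 : ‖inner ℂ ξ ((conjBy U a - b) ξ')‖ ≤ 1 / 4 := by
    refine (norm_inner_le_norm _ _).trans ?_
    rw [hξ, one_mul]
    refine ((conjBy U a - b).le_opNorm _).trans ?_
    rw [hξ', mul_one]
    exact hab.le
  have hb2 : ‖inner ℂ (ξ - η) (b ξ')‖ ≤ 1 / 4 := by
    refine (norm_inner_le_norm _ _).trans (le_trans ?_ hεb)
    have : ‖b ξ'‖ ≤ ‖b‖ := by simpa [hξ'] using b.le_opNorm ξ'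
    exact mul_le_mul (hR x) this (norm_nonneg _) (by positivity)
  have hb3 : ‖inner ℂ η (b (ξ' - η'))‖ ≤ 1 / 4 := by
    refine (norm_inner_le_norm _ _).trans (le_trans ?_ hεb)
    have : ‖b (ξ' - η')‖ ≤ ‖b‖ * ε :=
      (b.le_opNorm _).trans (mul_le_mul_of_nonneg_left (hR x') (norm_nonneg _))
    calc ‖η‖ * ‖b (ξ' - η')‖ ≤ 1 * (‖b‖ * ε) := by gcongr
      _ = ε * ‖b‖ := by ring
  have hfin : ‖(1 : ℂ)‖ ≤ 1 / 4 + 1 / 4 + 1 / 4 := by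
    rw [hsplit]
    exact (norm_add_le _ _).trans (add_le_add ((norm_add_le _ _).trans (add_le_add hb1 hb2)) hb3)
  rw [norm_one] at hfin
  norm_num at hfin

/-- The vector `U⁻¹ δ_{f x}` has modulus at least `δ` at `x`, but at most `δ / 2` away from `g (f
x)`. -/
theorem exists_dist_le_of_localizes {U : ell2 X ≃ₗᵢ[ℂ] ell2 Y} {f : X → Y} {g : Y → X}
    (hf : Localizes U f) (hg : Localizes U.symm g) : ∃ C : ℝ, ∀ x, dist x (g (f x)) ≤ C := by
  obtain ⟨δ, hδ, hlow⟩ := hf.1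
  obtain ⟨R, hR⟩ := hg.2 (δ / 2) (by positivity)
  refine ⟨R, fun x => ?_⟩
  by_contra hne
  have h1 := (norm_apply_le _ x).trans (hR (f x))
  have h2 : x ∉ Metric.closedBall (g (f x)) R := hne
  rw [lp.coeFn_sub, Pi.sub_apply, restr_apply_of_notMem h2, sub_zero, symm_basisVec_apply,
    norm_star] at h1
  linarith [hlow x]

theorem coarselyEquivalent_of_mapsRoe (hX : UniformlyLocallyFinite X)
    (hY : UniformlyLocallyFinite Y) {U : ell2 X ≃ₗᵢ[ℂ] ell2 Y} (hU : MapsRoe U)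
    (hU' : MapsRoe U.symm) : CoarselyEquivalent X Y := by
  obtain ⟨f, hf⟩ := exists_localizes hX hU hU'
  obtain ⟨g, hg⟩ := exists_localizes (U := U.symm) hY hU' hU
  exact ⟨f, g, isCoarse_of_localizes hX hU hf, isCoarse_of_localizes hY hU' hg,
    exists_dist_le_of_localizes hf hg, exists_dist_le_of_localizes (U := U.symm) hg hf⟩

end rigidity

/-! ### Spatial implementation of isomorphisms -/

section implementation

/-- With `ζ = q δ_z ≠ 0`, the compression `q e_zz q` is `v ↦ ⟨ζ, v⟩ ζ`, and minimality makes it a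
multiple of `q`. -/
theorem exists_rankOne {Z : Type*} [MetricSpace Z] {q : ell2 Z →L[ℂ] ell2 Z} (h0 : q ≠ 0)
    (hstar : star q = q) (hq : q * q = q)
    (hmin : ∀ b ∈ uniformRoeAlgebra Z, ∃ c : ℂ, q * b * q = c • q) :
    ∃ ξ : ell2 Z, ‖ξ‖ = 1 ∧ ∀ v, q v = inner ℂ ξ v • ξ := by
  obtain ⟨z, hz⟩ : ∃ z, q (basisVec z) ≠ 0 := by
    by_contra! h
    exact h0 (ext_basisVec fun x => by rw [h x]; rfl)
  have hsa : ∀ v w, inner ℂ (q v) w = inner ℂ v (q w) := by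
    intro v w
    rw [← ContinuousLinearMap.adjoint_inner_right, ← ContinuousLinearMap.star_eq_adjoint, hstar]
  have hqq : ∀ v, q (q v) = q v := fun v => by rw [← mul_apply_eq_comp, hq]
  obtain ⟨c, hc⟩ := hmin _ (matrixUnit_mem z z)
  set ζ := q (basisVec z) with hζ
  have hform : ∀ v, inner ℂ ζ v • ζ = c • q v := by
    intro v
    have h := congrArg (fun T : ell2 Z →L[ℂ] ell2 Z => T v) hc
    simp only [mul_apply_eq_comp, smul_apply, matrixUnit_apply, map_smul] at h
    rwa [← inner_basisVec, ← hsa] at h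
  have hn : ‖ζ‖ ≠ 0 := norm_ne_zero_iff.2 hz
  have hcn : (‖ζ‖ : ℂ) ^ 2 = c := by
    have h := hform ζ
    rw [inner_self_eq_norm_sq_to_K, hqq] at h
    exact smul_left_injective ℂ hz h
  have hnC : (‖ζ‖ : ℂ) ≠ 0 := by exact_mod_cast hn
  refine ⟨((‖ζ‖ : ℂ)⁻¹) • ζ, ?_, fun v => ?_⟩
  · rw [norm_smul, norm_inv, Complex.norm_real, norm_norm, inv_mul_cancel₀ hn]
  · have hv : q v = ((‖ζ‖ : ℂ) ^ 2)⁻¹ • inner ℂ ζ v • ζ := by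
      rw [hform, hcn, smul_smul, inv_mul_cancel₀ (by rw [← hcn]; positivity), one_smul]
    rw [hv, inner_smul_left, smul_smul, smul_smul]
    congr 1
    rw [map_inv₀, Complex.conj_ofReal]
    field_simp

variable {X Y : Type*}

/-- Subtracting `s • h` from `δ_y` leaves its coefficients along `ξ` unchanged, so Bessel keeps the
norm at least `1`. A small `s` in phase with `h y` would lower the norm unless `h y = 0`. -/
theorem orthogonal_span_eq_bot {ξ : X → ell2 Y} (hv : Orthonormal ℂ ξ)
    (hsum : ∀ y : Y, HasSum (fun x => ‖inner ℂ (ξ x) (basisVec y)‖ ^ 2) 1) :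
    (Submodule.span ℂ (Set.range ξ))ᗮ = ⊥ := by
  rw [Submodule.eq_bot_iff]
  intro h hh
  have hperp : ∀ x, inner ℂ (ξ x) h = (0 : ℂ) := fun x =>
    (Submodule.mem_orthogonal _ _).1 hh _ (Submodule.subset_span (Set.mem_range_self x))
  ext y
  set c : ℂ := h y with hc
  set ε : ℝ := 1 / (‖h‖ ^ 2 + 1) with hε
  have hεpos : 0 < ε := by positivity
  have hεh : ε * ‖h‖ ^ 2 ≤ 1 := by
    rw [hε, div_mul_eq_mul_div, div_le_one (by positivity)]
    linarith
  set s : ℂ := ε * star c with hs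
  have hbessel : 1 ≤ ‖basisVec y - s • h‖ ^ 2 := by
    refine hasSum_le_of_sum_le (hsum y) fun F => ?_
    refine le_trans (le_of_eq (Finset.sum_congr rfl fun x _ => ?_))
      (hv.sum_inner_products_le (basisVec y - s • h) (s := F))
    rw [inner_sub_right, inner_smul_right, hperp, mul_zero, sub_zero]
  have hs' : inner ℂ (basisVec y) (s • h) = ((ε * ‖c‖ ^ 2 : ℝ) : ℂ) := by
    rw [inner_smul_right, inner_basisVec, hs, mul_assoc, ← hc]
    have : star c * c = ((‖c‖ ^ 2 : ℝ) : ℂ) := by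
      rw [← Complex.normSq_eq_norm_sq, mul_comm]
      exact Complex.mul_conj c
    rw [this]
    push_cast
    ring
  rw [norm_sub_sq (𝕜 := ℂ), hs', norm_basisVec, norm_smul, hs, norm_mul, Complex.norm_real,
    norm_star, Real.norm_of_nonneg hεpos.le] at hbessel
  have hre : RCLike.re ((ε * ‖c‖ ^ 2 : ℝ) : ℂ) = ε * ‖c‖ ^ 2 := Complex.ofReal_re _
  rw [hre] at hbessel
  have h1 : (ε * ‖c‖ * ‖h‖) ^ 2 = (ε * ‖h‖ ^ 2) * (ε * ‖c‖ ^ 2) := by ring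
  have h2 : (ε * ‖h‖ ^ 2) * (ε * ‖c‖ ^ 2) ≤ 1 * (ε * ‖c‖ ^ 2) := by gcongr
  have h3 : ε * ‖c‖ ^ 2 ≤ 0 := by nlinarith
  have h4 : ‖c‖ ^ 2 ≤ 0 := by
    by_contra! hpos
    exact absurd (mul_pos hεpos hpos) (not_lt.2 h3)
  exact norm_eq_zero.1 (pow_eq_zero_iff two_ne_zero |>.1 (le_antisymm h4 (by positivity)))

variable [MetricSpace X] [MetricSpace Y]

/-- The matrix unit as an element of the uniform Roe algebra. -/
def roeUnit (x y : X) : uniformRoeAlgebra X := ⟨matrixUnit x y, matrixUnit_mem x y⟩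

theorem star_roeUnit (x y : X) : star (roeUnit x y) = roeUnit y x :=
  Subtype.ext (star_matrixUnit x y)

theorem roeUnit_mul_mul (a : uniformRoeAlgebra X) (x y z w : X) :
    roeUnit x y * a * roeUnit z w = entry (a : ell2 X →L[ℂ] ell2 X) y z • roeUnit x w :=
  Subtype.ext (matrixUnit_mul_mul a.1 x y z w)

theorem roeUnit_mul_self (x y w : X) : roeUnit x y * roeUnit y w = roeUnit x w :=
  Subtype.ext (matrixUnit_mul_self x y w)

theorem roeUnit_mul_of_ne (x w : X) {y z : X} (h : y ≠ z) : roeUnit x y * roeUnit z w = 0 :=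
  Subtype.ext (matrixUnit_mul_of_ne x w h)

theorem roeUnit_ne_zero (x y : X) : roeUnit x y ≠ 0 := by
  intro h
  have h1 : matrixUnit x y (basisVec y) x = 0 := by
    rw [show matrixUnit x y = 0 from congrArg Subtype.val h]
    rfl
  rw [matrixUnit_apply, basisVec_apply_self, one_smul, basisVec_apply_self] at h1
  exact one_ne_zero h1

theorem star_apply_starAlgEquiv (Φ : uniformRoeAlgebra X ≃⋆ₐ[ℂ] uniformRoeAlgebra Y)
    (a : uniformRoeAlgebra X) : star (Φ a) = Φ (star a) :=
  (Φ.map_star' a).symm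

theorem exists_rankOne_image (Φ : uniformRoeAlgebra X ≃⋆ₐ[ℂ] uniformRoeAlgebra Y) (x : X) :
    ∃ ξ : ell2 Y, ‖ξ‖ = 1 ∧
      ∀ v, (Φ (roeUnit x x) : ell2 Y →L[ℂ] ell2 Y) v = inner ℂ ξ v • ξ := by
  refine exists_rankOne (fun h => roeUnit_ne_zero x x ?_) ?_ ?_ fun b hb => ?_
  · exact (map_eq_zero_iff Φ Φ.injective).1 (Subtype.ext h)
  · exact congrArg Subtype.val
      (show star (Φ (roeUnit x x)) = _ by rw [star_apply_starAlgEquiv, star_roeUnit])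
  · exact congrArg Subtype.val
      (show Φ (roeUnit x x) * Φ (roeUnit x x) = _ by rw [← map_mul, roeUnit_mul_self])
  · refine ⟨entry (Φ.symm ⟨b, hb⟩ : ell2 X →L[ℂ] ell2 X) x x, ?_⟩
    have h := congrArg Φ (roeUnit_mul_mul (Φ.symm ⟨b, hb⟩) x x x x)
    rw [map_mul, map_mul, map_smul, Φ.apply_symm_apply] at h
    exact congrArg Subtype.val h

/-- The images of the matrix units form the matrix units of an orthonormal family. -/
theorem exists_orthonormal_matrixUnits [Nonempty X]
    (Φ : uniformRoeAlgebra X ≃⋆ₐ[ℂ] uniformRoeAlgebra Y) :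
    ∃ ξ : X → ell2 Y, Orthonormal ℂ ξ ∧
      ∀ x z v, (Φ (roeUnit x z) : ell2 Y →L[ℂ] ell2 Y) v = inner ℂ (ξ z) v • ξ x := by
  classical
  obtain ⟨x₀⟩ := ‹Nonempty X›
  obtain ⟨ξ₀, hξ₀, hP₀⟩ := exists_rankOne_image Φ x₀
  set P : X → X → ell2 Y →L[ℂ] ell2 Y := fun x z => Φ (roeUnit x z) with hP
  have hmul : ∀ x y w v, P x y (P y w v) = P x w v := by
    intro x y w v
    have h : Φ (roeUnit x y) * Φ (roeUnit y w) = Φ (roeUnit x w) := by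
      rw [← map_mul, roeUnit_mul_self]
    exact congrArg (fun T : uniformRoeAlgebra Y => T.1 v) h
  have hmul0 : ∀ x w v {y z}, y ≠ z → P x y (P z w v) = 0 := by
    intro x w v y z hne
    have h : Φ (roeUnit x y) * Φ (roeUnit z w) = 0 := by
      rw [← map_mul, roeUnit_mul_of_ne x w hne, map_zero]
    exact congrArg (fun T : uniformRoeAlgebra Y => T.1 v) h
  have hadj : ∀ x y v w, inner ℂ (P x y v) w = inner ℂ v (P y x w) := by
    intro x y v w
    have h : star (Φ (roeUnit x y)) = Φ (roeUnit y x) := by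
      rw [star_apply_starAlgEquiv, star_roeUnit]
    have h' : star (P x y) = P y x := congrArg Subtype.val h
    rw [← h', ContinuousLinearMap.star_eq_adjoint, ContinuousLinearMap.adjoint_inner_right]
  have hξξ : inner ℂ ξ₀ ξ₀ = (1 : ℂ) := by
    rw [inner_self_eq_norm_sq_to_K, hξ₀]
    simp
  have hP₀' : P x₀ x₀ ξ₀ = ξ₀ := by
    have := hP₀ ξ₀
    rwa [hξξ, one_smul] at this
  refine ⟨fun x => P x x₀ ξ₀, ?_, fun x z v => ?_⟩
  · rw [orthonormal_iff_ite]
    intro x x'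
    rw [hadj]
    split_ifs with h
    · rw [h, hmul, hP₀', hξξ]
    · rw [hmul0 _ _ _ h, inner_zero_right]
  · change P x z v = _
    -- Factor `P x z` as `P x x₀ * P x₀ x₀ * P x₀ z`, whose middle factor has rank one.
    rw [hadj, ← map_smul, ← hP₀ (P x₀ z v)]
    change _ = P x x₀ (P x₀ x₀ (P x₀ z v))
    rw [hmul, hmul]

/-- This makes the family `ξ` total. `Φ⁻¹(e_yy)` is the projection onto a unit vector `η`, and
compressing `e_xx` by it identifies each term with `‖η x‖²`. -/
theorem hasSum_norm_sq_of_matrixUnits (Φ : uniformRoeAlgebra X ≃⋆ₐ[ℂ] uniformRoeAlgebra Y)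
    {ξ : X → ell2 Y}
    (hξ : ∀ x z v, (Φ (roeUnit x z) : ell2 Y →L[ℂ] ell2 Y) v = inner ℂ (ξ z) v • ξ x) (y : Y) :
    HasSum (fun x => ‖inner ℂ (ξ x) (basisVec y)‖ ^ 2) 1 := by
  obtain ⟨η, hη, hQ⟩ := exists_rankOne_image Φ.symm y
  have h := hasSum_norm_sq η
  rw [hη, one_pow] at h
  convert h using 2 with x
  have h1 : Φ.symm (roeUnit y y) * roeUnit x x * Φ.symm (roeUnit y y) =
      ((‖η x‖ : ℂ) ^ 2) • Φ.symm (roeUnit y y) := by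
    refine Subtype.ext (ContinuousLinearMap.ext fun v => ?_)
    change (Φ.symm (roeUnit y y)).1 (matrixUnit x x ((Φ.symm (roeUnit y y)).1 v)) =
      ((‖η x‖ : ℂ) ^ 2) • (Φ.symm (roeUnit y y)).1 v
    rw [hQ, hQ, matrixUnit_apply, inner_smul_right, smul_smul]
    congr 1
    rw [← inner_conj_symm η (basisVec x), inner_basisVec]
    change (inner ℂ η v * η x) * _ = _
    rw [mul_assoc, Complex.mul_conj, Complex.normSq_eq_norm_sq]
    push_cast
    ring
  have h2 := congrArg Φ h1
  rw [map_mul, map_mul, map_smul, Φ.apply_symm_apply, roeUnit_mul_mul] at h2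
  have h3 : entry (Φ (roeUnit x x) : ell2 Y →L[ℂ] ell2 Y) y y = (‖η x‖ : ℂ) ^ 2 :=
    smul_left_injective ℂ (roeUnit_ne_zero y y) h2
  rw [entry_eq_inner, hξ, inner_smul_right, ← inner_conj_symm (basisVec y), Complex.mul_conj,
    Complex.normSq_eq_norm_sq] at h3
  exact_mod_cast h3

/-- Isomorphisms of uniform Roe algebras are implemented by unitaries. -/
theorem exists_unitary [Nonempty X] (Φ : uniformRoeAlgebra X ≃⋆ₐ[ℂ] uniformRoeAlgebra Y) :
    ∃ U : ell2 X ≃ₗᵢ[ℂ] ell2 Y,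
      ∀ a : uniformRoeAlgebra X, conjBy U.symm (Φ a : ell2 Y →L[ℂ] ell2 Y) = a := by
  classical
  obtain ⟨ξ, hv, hξ⟩ := exists_orthonormal_matrixUnits Φ
  set B := HilbertBasis.mkOfOrthogonalEqBot hv
    (orthogonal_span_eq_bot hv (hasSum_norm_sq_of_matrixUnits Φ hξ))
  have hB : ∀ x, B.repr.symm (basisVec x) = ξ x := by
    intro x
    have h : B x = ξ x := by rw [HilbertBasis.coe_mkOfOrthogonalEqBot]
    rw [← h, ← B.repr_symm_single x, basisVec]
  refine ⟨B.repr.symm, fun a => ext_basisVec fun x' => ?_⟩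
  ext x
  rw [conjBy_apply, ← inner_basisVec, LinearIsometryEquiv.symm_symm, hB,
    ← B.repr.symm.inner_map_map, B.repr.symm_apply_apply, hB]
  -- Entries of `a` are encoded algebraically by `e_xx a e_x'x'`, so no continuity of `Φ` is needed.
  have h := congrArg Φ (roeUnit_mul_mul a x x x' x')
  rw [map_mul, map_mul, map_smul] at h
  have h' := congrArg (fun T : uniformRoeAlgebra Y => T.1 (ξ x')) h
  change (Φ (roeUnit x x)).1 ((Φ a).1 ((Φ (roeUnit x' x')).1 (ξ x'))) =
    entry (a : ell2 X →L[ℂ] ell2 X) x x' • (Φ (roeUnit x x')).1 (ξ x') at h'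
  have h1 : inner ℂ (ξ x') (ξ x') = (1 : ℂ) := by
    rw [inner_self_eq_norm_sq_to_K, hv.1]
    simp
  rw [hξ, hξ, hξ, h1, one_smul, one_smul] at h'
  exact smul_left_injective ℂ (hv.ne_zero x) h'

theorem nonempty_of_starAlgEquiv (Φ : uniformRoeAlgebra X ≃⋆ₐ[ℂ] uniformRoeAlgebra Y)
    (x : X) : Nonempty Y := by
  by_contra hY
  rw [not_nonempty_iff] at hY
  refine roeUnit_ne_zero x x ((map_eq_zero_iff Φ Φ.injective).1 (Subtype.ext ?_))
  exact ContinuousLinearMap.ext fun v => lp.eq_zero' _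

end implementation

end UniformRoe

end

theorem theorem1p1 {X : Type*} {Y : Type*} [MetricSpace X] [MetricSpace Y]
    (hX : UniformRoe.UniformlyLocallyFinite X) (hY : UniformRoe.UniformlyLocallyFinite Y)
    (hiso : Nonempty (UniformRoe.uniformRoeAlgebra X ≃⋆ₐ[ℂ] UniformRoe.uniformRoeAlgebra Y)) :
    UniformRoe.CoarselyEquivalent X Y := by
  obtain ⟨Φ⟩ := hiso
  -- The unitary is built from a base point of `X`.
  cases isEmpty_or_nonempty X with
  | inl hempty =>
    have hYe : IsEmpty Y := ⟨fun y =>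
      not_nonempty_iff.2 hempty (UniformRoe.nonempty_of_starAlgEquiv Φ.symm y)⟩
    exact ⟨isEmptyElim, isEmptyElim, fun r hr => ⟨r, hr, isEmptyElim⟩,
      fun r hr => ⟨r, hr, isEmptyElim⟩, ⟨0, isEmptyElim⟩, ⟨0, isEmptyElim⟩⟩
  | inr _ =>
    obtain ⟨U, hU⟩ := UniformRoe.exists_unitary Φ
    refine UniformRoe.coarselyEquivalent_of_mapsRoe hX hY (U := U) (fun a ha => ?_) fun b hb => ?_
    · have h : UniformRoe.conjBy U a = Φ ⟨a, ha⟩ := by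
        have h1 := hU ⟨a, ha⟩
        ext1 v
        change UniformRoe.conjBy U (⟨a, ha⟩ : UniformRoe.uniformRoeAlgebra X) v = _
        rw [← h1, UniformRoe.conjBy_apply, UniformRoe.conjBy_apply]
        simp
      rw [h]
      exact (Φ ⟨a, ha⟩).2
    · have h1 := hU (Φ.symm ⟨b, hb⟩)
      rw [Φ.apply_symm_apply] at h1
      rw [h1]
      exact (Φ.symm ⟨b, hb⟩).2
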